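/- All spaces are Tychonoff (completely regular and $T_0$). Let $E$ be a space that is a $k$-space (a set $A\subseteq E$ is closed whenever $A\cap K$ is closed in $K$ for every compact $K\subseteq E$), equipped with a partition $E=\bigsqcup_{n\ge 0}E_n$ into clopen (possibly empty) subsets; the elements of $E_n$ are the $n$-ary operation symbols. An $E$-algebra is a set $X$ together with maps $\Psi^X_n\colon E_n\times X^n\to X$, $n\ge 0$. An $E$-algebra $X$ with a topology is called a topological $E$-algebra if all the maps $\Psi^X_n$ are continuous, and a semitopological $E$-algebra if all the maps $\Psi^X_n$ are separately continuous, that is, continuous in each of the $n+1$ variables in $E_n,X,\dots,X$ when the other $n$ variables are fixed. Let $X$ be a topological $E$-algebra whose underlying space is pseudocompact (Tychonoff, and every continuous function $X\to\mathbb R$ is bounded), and let $\beta X$ be its Stone–Čech compactification. Then for every $n\ge 0$ the map $\Psi^X_n$ extends to a separately continuous map $\Psi^{\beta X}_n\colon E_n\times(\beta X)^n\to\beta X$. That is, $\beta X$ carries the structure of a semitopological $E$-algebra for which the canonical embedding $X\to\beta X$ is a homomorphism. -/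

import Mathlib

/-- A Tychonoff space on which every continuous real-valued function is bounded. -/
class PseudocompactSpace (X : Type*) [TopologicalSpace X] : Prop extends T35Space X where
  exists_bound : ∀ f : X → ℝ, Continuous f → ∃ C : ℝ, ∀ x, |f x| ≤ C

/-- The structure of a continuous signature on a topological space `E`: each symbol has a finite
arity, and the set `E_n` of symbols of arity `n` is clopen for every `n`. -/
structure ContinuousSignature (E : Type*) [TopologicalSpace E] where
  arity : E → ℕ
  isClopen_fiber : ∀ n, IsClopen (arity ⁻¹' {n})

/-- The subspace `E_n` of `n`-ary symbols, with the subspace topology. -/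
abbrev ContinuousSignature.Symbols {E : Type*} [TopologicalSpace E] (σ : ContinuousSignature E)
    (n : ℕ) : Type _ :=
  {t : E // σ.arity t = n}

/-- An `E`-algebra structure on `X`: a family of maps `Ψ_n : E_n × X ^ n → X`. -/
structure EAlgebra {E : Type*} [TopologicalSpace E] (σ : ContinuousSignature E) (X : Type*) where
  op : (n : ℕ) → σ.Symbols n × (Fin n → X) → X

/-- Separate continuity of a map `T × X ^ n → Y`, as a map of its `n + 1` arguments. -/
def IsSeparatelyContinuous {T X Y : Type*} [TopologicalSpace T] [TopologicalSpace X]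
    [TopologicalSpace Y] {n : ℕ} (Φ : T × (Fin n → X) → Y) : Prop :=
  (∀ x : Fin n → X, Continuous fun t : T => Φ (t, x)) ∧
    ∀ (t : T) (x : Fin n → X) (i : Fin n), Continuous fun y : X => Φ (t, Function.update x i y)

namespace EAlgebra

variable {E : Type*} [TopologicalSpace E] {σ : ContinuousSignature E} {X Y : Type*}

/-- Topological `E`-algebra: all maps `Ψ_n : E_n × X ^ n → X` are jointly continuous. -/
def IsTopological [TopologicalSpace X] (A : EAlgebra σ X) : Prop :=
  ∀ n, Continuous (A.op n)

/-- Semitopological `E`-algebra: all maps `Ψ_n : E_n × X ^ n → X` are separately continuous. -/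
def IsSemitopological [TopologicalSpace X] (A : EAlgebra σ X) : Prop :=
  ∀ n, IsSeparatelyContinuous (A.op n)

/-- Homomorphisms of `E`-algebras. -/
def IsHom (A : EAlgebra σ X) (B : EAlgebra σ Y) (φ : X → Y) : Prop :=
  ∀ (n : ℕ) (t : σ.Symbols n) (x : Fin n → X), φ (A.op n (t, x)) = B.op n (t, φ ∘ x)

end EAlgebra

/-!
The operations are extended to `βX` one variable at a time. Extending a variable is possible for
every fixed value of the others, and what may fail is continuity in these other variables. A failure
produces two sequences violating Grothendieck's double limit condition. On a pseudocompact space a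
sequence of nonempty open sets has a cluster point; this yields the double limit condition for a
continuous function on a product of two pseudocompact spaces, and for a separately continuous one if
one of the factors is compact. It also shows that countably many continuous functions take at some
point of `X` the same values as at a given point of `βX`, so a double limit condition with a
parameter in `X` persists when the parameter is moved to `βX`. Continuity in the operation symbol
can be tested on compact sets, where it follows from the case of a compact factor.
-/

open Filter Function Set Topology

namespace PseudocompactSpace

variable {X : Type*} [TopologicalSpace X] [PseudocompactSpace X]

theorem not_locallyFinite {V : ℕ → Set X} (hV : ∀ n, IsOpen (V n)) (hne : ∀ n, (V n).Nonempty) :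
    ¬ LocallyFinite V := by
  intro hlf
  choose x hx using hne
  have bump (n) : ∃ φ : X → ℝ, Continuous φ ∧ 0 ≤ φ ∧ φ (x n) = 1 ∧ ∀ y ∉ V n, φ y = 0 := by
    obtain ⟨g, hg, h0, h1⟩ := CompletelyRegularSpace.completely_regular (x n) (V n)ᶜ
      (hV n).isClosed_compl (notMem_compl_iff.2 (hx n))
    exact ⟨fun y => 1 - g y, by fun_prop, fun y => sub_nonneg.2 (g y).2.2, by simp [h0],
      fun y hy => by simp [h1 hy]⟩
  choose φ hφc hφ0 hφ1 hφV using bump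
  have hsupp : LocallyFinite fun n : ℕ => support fun y => (n : ℝ) * φ n y :=
    hlf.subset fun n y hy => by
      by_contra hyV
      exact hy (by simp [hφV n y hyV])
  obtain ⟨C, hC⟩ := exists_bound _
    (continuous_finsum (fun n => continuous_const.mul (hφc n)) hsupp)
  obtain ⟨n, hn⟩ := exists_nat_gt C
  have hle : (n : ℝ) * φ n (x n) ≤ ∑ᶠ m : ℕ, (m : ℝ) * φ m (x n) :=
    single_le_finsum n (hsupp.point_finite (x n)) fun m => mul_nonneg m.cast_nonneg (hφ0 m _)
  rw [hφ1, mul_one] at hle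
  exact (hn.trans_le (hle.trans (le_abs_self _))).not_ge (hC (x n))

theorem exists_forall_mem_of_isClosed {V : ℕ → Set X} (hV : ∀ n, IsOpen (V n))
    (hne : ∀ n, (V n).Nonempty) :
    ∃ x, ∀ C : Set X, IsClosed C → (∀ᶠ n in atTop, V n ⊆ C) → x ∈ C := by
  by_contra! h
  refine not_locallyFinite hV hne fun x => ?_
  obtain ⟨C, hC, hVC, hx⟩ := h x
  refine ⟨Cᶜ, hC.isOpen_compl.mem_nhds hx, ?_⟩
  rw [← Nat.cofinite_eq_atTop] at hVC
  exact hVC.subset fun n hn => inter_compl_nonempty_iff.1 hn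

theorem exists_forall_mem_closure {κ : Type*} [Countable κ] {U : κ → Set X}
    (hU : ∀ k, IsOpen (U k)) (hne : ∀ s : Finset κ, (⋂ k ∈ s, U k).Nonempty) :
    ∃ x, ∀ k, x ∈ closure (U k) := by
  obtain ⟨f, hf⟩ := Countable.exists_injective_nat κ
  have hfin (n : ℕ) : {k | f k ≤ n}.Finite := (finite_Iic n).preimage hf.injOn
  obtain ⟨x, hx⟩ := exists_forall_mem_of_isClosed (V := fun n => ⋂ k ∈ {k | f k ≤ n}, U k)
    (fun n => (hfin n).isOpen_biInter fun k _ => hU k)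
    (fun n => by simpa using hne (hfin n).toFinset)
  refine ⟨x, fun k => hx _ isClosed_closure ?_⟩
  filter_upwards [eventually_ge_atTop (f k)] with n hn
  exact Subset.trans (biInter_subset_of_mem hn) subset_closure

end PseudocompactSpace

theorem continuous_of_forall_upperSemicontinuous_comp {W Z : Type*} [TopologicalSpace W]
    [TopologicalSpace Z] [CompletelyRegularSpace Z] {h : W → Z}
    (H : ∀ φ : Z → ℝ, Continuous φ → UpperSemicontinuous fun w => φ (h w)) : Continuous h := by
  refine continuous_iff_continuousAt.2 fun w => tendsto_nhds.2 fun O hO hw => ?_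
  obtain ⟨g, hg, h0, h1⟩ := CompletelyRegularSpace.completely_regular (h w) Oᶜ
    hO.isClosed_compl (notMem_compl_iff.2 hw)
  filter_upwards [H (fun z => g z) (by fun_prop) w 1 (by simp [h0])] with v hv
  by_contra hvO
  simp [h1 hvO] at hv

/-- Grothendieck's double limit condition, in its order-property form: no continuous real function
separates the values of `g` along two sequences above the diagonal from those below it. For bounded
real `g` this says that iterated limits along sequences agree whenever they exist. -/
def DoubleLimitProperty {A B Z : Type*} [TopologicalSpace Z] (g : A → B → Z) : Prop :=
  ∀ φ : Z → ℝ, Continuous φ → ∀ (x : ℕ → A) (y : ℕ → B) (r s : ℝ),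
    (∀ n m, n < m → φ (g (x n) (y m)) ≤ r) → (∀ n m, m < n → s ≤ φ (g (x n) (y m))) → s ≤ r

namespace DoubleLimitProperty

variable {A B Z : Type*} [TopologicalSpace Z]

theorem flip {g : A → B → Z} (hg : DoubleLimitProperty g) :
    DoubleLimitProperty fun b a => g a b := fun φ hφ x y r s hr hs =>
  neg_le_neg_iff.1 <| hg (fun z => -φ z) hφ.neg y x (-s) (-r)
    (fun n m h => neg_le_neg (hs m n h)) (fun n m h => neg_le_neg (hr m n h))

theorem comp_left {A' : Type*} {g : A → B → Z} (hg : DoubleLimitProperty g) (e : A' → A) :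
    DoubleLimitProperty fun a b => g (e a) b := fun φ hφ x =>
  hg φ hφ (e ∘ x)

end DoubleLimitProperty

theorem exists_seq_of_not_upperSemicontinuousAt {Y K X : Type*} [TopologicalSpace K]
    [TopologicalSpace X] {e : Y → K} (he : DenseRange e) {G : K → X → ℝ}
    (hG : ∀ x, Continuous fun a => G a x) {p : K} {x₀ : X}
    (hp : ¬ UpperSemicontinuousAt (G p) x₀) :
    ∃ r s, r < s ∧ ∀ N : Y → Set X, (∀ y, G (e y) x₀ < r → N y ∈ 𝓝 x₀) →
      ∃ (y : ℕ → Y) (x : ℕ → X), (∀ n, G (e (y n)) x₀ < r) ∧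
        (∀ n m, n < m → x m ∈ N (y n)) ∧ ∀ n m, m < n → s < G (e (y n)) (x m) := by
  simp only [upperSemicontinuousAt_iff, not_forall, not_eventually, not_lt, exists_prop] at hp
  obtain ⟨t, hpt, hfreq⟩ := hp
  obtain ⟨r, hpr, hrt⟩ := exists_between hpt
  obtain ⟨s, hrs, hst⟩ := exists_between hrt
  refine ⟨r, s, hrs, fun N hN => ?_⟩
  -- Choose `x n` close to `x₀` with `G p (x n)` large, then `e (y n)` close to `p`, recursively.
  obtain ⟨d, hd, hdd⟩ := exists_seq_of_forall_finset_exists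
    (fun d : Y × X => G (e d.1) x₀ < r ∧ s < G p d.2)
    (fun d d' => d'.2 ∈ N d.1 ∧ s < G (e d'.1) d.2) fun D hD => by
      have hx : ∀ᶠ x in 𝓝 x₀, ∀ d ∈ D, x ∈ N d.1 :=
        (Finset.eventually_all D).2 fun d hd => hN _ (hD d hd).1
      have ha : ∀ᶠ a in 𝓝 p, G a x₀ < r ∧ ∀ d ∈ D, s < G a d.2 :=
        ((hG x₀).continuousAt.eventually_lt_const hpr).and <| (Finset.eventually_all D).2
          fun d hd => (hG d.2).continuousAt.eventually_const_lt (hD d hd).2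
      obtain ⟨x, hpx, hxN⟩ := (hfreq.and_eventually hx).exists
      obtain ⟨y, hy₀, hyD⟩ := he.exists_mem_open isOpen_interior ⟨p, mem_interior_iff_mem_nhds.2 ha⟩
        |>.imp fun _ h => interior_subset h
      exact ⟨(y, x), ⟨hy₀, hst.trans_le hpx⟩, fun d hd => ⟨hxN d hd, hyD d hd⟩⟩
  exact ⟨fun n => (d n).1, fun n => (d n).2, fun n => (hd n).1, fun n m h => (hdd n m h).1,
    fun n m h => (hdd m n h).2⟩

theorem DoubleLimitProperty.continuous_of_denseRange {Y K X Z : Type*} [TopologicalSpace K]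
    [TopologicalSpace X] [TopologicalSpace Z] [CompletelyRegularSpace Z] {e : Y → K}
    {G : K → X → Z} (hG : DoubleLimitProperty fun y x => G (e y) x) (he : DenseRange e)
    (hGK : ∀ x, Continuous fun a => G a x) (hGX : ∀ y, Continuous (G (e y))) (p : K) :
    Continuous (G p) := by
  refine continuous_of_forall_upperSemicontinuous_comp fun φ hφ x₀ => ?_
  by_contra hp
  obtain ⟨r, s, hrs, hseq⟩ := exists_seq_of_not_upperSemicontinuousAt he
    (G := fun a x => φ (G a x)) (fun x => hφ.comp (hGK x)) hp
  obtain ⟨y, x, -, hr, hs⟩ := hseq (fun y => {x | φ (G (e y) x) < r}) fun y hy =>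
    (hφ.comp (hGX y)).continuousAt.eventually_lt_const hy
  exact hrs.not_ge <| hG φ hφ y x r s (fun n m h => (hr n m h).le) (fun n m h => (hs n m h).le)

namespace PseudocompactSpace

variable {X : Type*} [TopologicalSpace X] [PseudocompactSpace X]

theorem doubleLimitProperty_of_compactSpace {L Z : Type*} [TopologicalSpace L] [CompactSpace L]
    [TopologicalSpace Z] {g : X → L → Z} (hX : ∀ b, Continuous fun x => g x b)
    (hL : ∀ x, Continuous (g x)) : DoubleLimitProperty g := by
  intro φ hφ x y r s hr hs
  have hφX (b) : Continuous fun x => φ (g x b) := hφ.comp (hX b)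
  have hφL (x) : Continuous fun b => φ (g x b) := hφ.comp (hL x)
  obtain ⟨b, hb⟩ := exists_clusterPt_of_compactSpace (map y atTop)
  have mem_of_eventually {C : Set L} (hC : IsClosed C) (hyC : ∀ᶠ n in atTop, y n ∈ C) : b ∈ C :=
    isClosed_iff_clusterPt.1 hC b (hb.mono (le_principal_iff.2 hyC))
  have hrb (n) : φ (g (x n) b) ≤ r :=
    mem_of_eventually (isClosed_le (hφL (x n)) continuous_const)
      ((eventually_gt_atTop n).mono fun m => hr n m)
  by_contra! hrs
  obtain ⟨u, hru, hus⟩ := exists_between hrs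
  obtain ⟨v, huv, hvs⟩ := exists_between hus
  obtain ⟨z, hz⟩ := exists_forall_mem_closure
    (U := fun k => {x | φ (g x b) < u} ∩ {x | v < φ (g x (y k))})
    (fun k => (isOpen_lt (hφX b) continuous_const).inter (isOpen_lt continuous_const (hφX (y k))))
    fun D => by
      obtain ⟨n, hn⟩ := ((Finset.eventually_all D).2 fun k _ => eventually_gt_atTop k).exists
      exact ⟨x n, mem_iInter₂.2 fun k hk =>
        ⟨(hrb n).trans_lt hru, hvs.trans_le (hs n k (hn k hk))⟩⟩
  have hzk (k) : φ (g z b) ≤ u ∧ v ≤ φ (g z (y k)) :=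
    ⟨closure_lt_subset_le (hφX b) continuous_const (closure_mono inter_subset_left (hz k)),
      closure_lt_subset_le continuous_const (hφX (y k)) (closure_mono inter_subset_right (hz k))⟩
  have hvz : v ≤ φ (g z b) :=
    mem_of_eventually (isClosed_le continuous_const (hφL z)) (.of_forall fun k => (hzk k).2)
  exact (huv.trans_le (hvz.trans (hzk 0).1)).false

theorem continuous_of_compactSpace {K L Z : Type*} [TopologicalSpace K] [TopologicalSpace L]
    [CompactSpace L] [TopologicalSpace Z] [CompletelyRegularSpace Z] {e : X → K}
    (he : Continuous e) (hd : DenseRange e) {G : K → L → Z} (hK : ∀ b, Continuous fun a => G a b)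
    (hL : ∀ x, Continuous (G (e x))) (p : K) : Continuous (G p) :=
  (doubleLimitProperty_of_compactSpace (fun b => (hK b).comp he) hL).continuous_of_denseRange
    hd hK hL p

theorem exists_forall_apply_eq {K κ : Type*} [TopologicalSpace K] [Countable κ] {e : X → K}
    (he : Continuous e) (hd : DenseRange e) {ψ : κ → K → ℝ} (hψ : ∀ k, Continuous (ψ k)) (p : K) :
    ∃ x, ∀ k, ψ k (e x) = ψ k p := by
  let V (k : κ × ℕ) : Set K := {q | dist (ψ k.1 q) (ψ k.1 p) < 1 / ((k.2 : ℝ) + 1)}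
  have hV (k) : IsOpen (V k) := isOpen_lt ((hψ k.1).dist continuous_const) continuous_const
  have hpV (k) : p ∈ V k := (dist_self _).trans_lt Nat.one_div_pos_of_nat
  obtain ⟨x, hx⟩ := exists_forall_mem_closure (U := fun k => e ⁻¹' V k)
    (fun k => (hV k).preimage he) fun D => by
      obtain ⟨x, hx⟩ := hd.exists_mem_open (isOpen_biInter_finset fun k (_ : k ∈ D) => hV k)
        ⟨p, mem_iInter₂.2 fun k _ => hpV k⟩
      exact ⟨x, by simpa using hx⟩
  refine ⟨x, fun k => dist_le_zero.1 <|
    ge_of_tendsto' tendsto_one_div_add_atTop_nhds_zero_nat fun n => ?_⟩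
  exact closure_lt_subset_le (((hψ k).comp he).dist continuous_const) continuous_const (hx (k, n))

theorem doubleLimitProperty_of_denseRange {K A B Z : Type*} [TopologicalSpace K]
    [TopologicalSpace Z] {e : X → K} (he : Continuous e) (hd : DenseRange e) {G : K → A → B → Z}
    (hK : ∀ a b, Continuous fun p => G p a b) (hG : ∀ x, DoubleLimitProperty (G (e x))) (p : K) :
    DoubleLimitProperty (G p) := by
  intro φ hφ a b r s hr hs
  obtain ⟨x, hx⟩ := exists_forall_apply_eq he hd
    (fun k : ℕ × ℕ => hφ.comp (hK (a k.1) (b k.2))) p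
  have hx' (n m) : φ (G (e x) (a n) (b m)) = φ (G p (a n) (b m)) := hx (n, m)
  exact hG x φ hφ a b r s (fun n m h => (hx' n m).trans_le (hr n m h))
    fun n m h => (hs n m h).trans_eq (hx' n m).symm

theorem le_of_forall_mem_box {Y : Type*} [TopologicalSpace Y] [PseudocompactSpace Y]
    {h : Y → X → ℝ} (hY : ∀ x, Continuous fun y => h y x) (hX : ∀ y, Continuous (h y))
    {V : ℕ → Set Y} {U : ℕ → Set X} (hV : ∀ n, IsOpen (V n)) (hU : ∀ n, IsOpen (U n))
    {y : ℕ → Y} {x : ℕ → X} (hyV : ∀ n, y n ∈ V n) (hxU : ∀ n m, n < m → x m ∈ U n) {r s : ℝ}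
    (hr : ∀ n, ∀ y ∈ V n, ∀ x ∈ U n, h y x ≤ r) (hs : ∀ n m, m < n → s ≤ h (y n) (x m)) :
    s ≤ r := by
  by_contra! hrs
  obtain ⟨u, hru, hus⟩ := exists_between hrs
  obtain ⟨v, huv, hvs⟩ := exists_between hus
  obtain ⟨q, hq⟩ := exists_forall_mem_of_isClosed
    (V := fun n => V n ∩ ⋂ m ∈ Finset.range n, {y | v < h y (x m)})
    (fun n => (hV n).inter <| isOpen_biInter_finset fun m _ => isOpen_lt continuous_const (hY _))
    fun n => ⟨y n, hyV n, mem_iInter₂.2 fun m hm => hvs.trans_le (hs n m (Finset.mem_range.1 hm))⟩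
  have hvq (m) : v ≤ h q (x m) := by
    refine hq {y | v ≤ h y (x m)} (isClosed_le continuous_const (hY (x m))) ?_
    filter_upwards [eventually_gt_atTop m] with n hn z hz
    have hvz : v < h z (x m) := mem_iInter₂.1 hz.2 m (Finset.mem_range.2 hn)
    exact hvz.le
  obtain ⟨p, hp⟩ := exists_forall_mem_closure (U := fun k => U k ∩ {x | u < h q x})
    (fun k => (hU k).inter (isOpen_lt continuous_const (hX q))) fun D => by
      obtain ⟨m, hm⟩ := ((Finset.eventually_all D).2 fun k _ => eventually_gt_atTop k).exists
      exact ⟨x m, mem_iInter₂.2 fun k hk => ⟨hxU k m (hm k hk), huv.trans_le (hvq m)⟩⟩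
  have hup : u ≤ h q p :=
    closure_lt_subset_le continuous_const (hX q) (closure_mono inter_subset_right (hp 0))
  have hpr : h q p ≤ r :=
    hq {y | h y p ≤ r} (isClosed_le (hY p) continuous_const) <| .of_forall fun n z hz =>
      closure_minimal (fun w hw => hr n z hz.1 w hw.1) (isClosed_le (hX z) continuous_const) (hp n)
  exact (hru.trans_le (hup.trans hpr)).false

theorem continuous_of_continuous_uncurry {Y K Z : Type*} [TopologicalSpace Y]
    [PseudocompactSpace Y] [TopologicalSpace K] [TopologicalSpace Z] [CompletelyRegularSpace Z]
    {e : Y → K} (hd : DenseRange e) {G : K → X → Z} (hK : ∀ x, Continuous fun a => G a x)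
    (hYX : Continuous fun z : Y × X => G (e z.1) z.2) (p : K) : Continuous (G p) := by
  refine continuous_of_forall_upperSemicontinuous_comp fun φ hφ x₀ => ?_
  by_contra hp
  obtain ⟨r, s, hrs, hseq⟩ := exists_seq_of_not_upperSemicontinuousAt hd
    (G := fun a x => φ (G a x)) (fun x => hφ.comp (hK x)) hp
  have hφYX : Continuous fun z : Y × X => φ (G (e z.1) z.2) := hφ.comp hYX
  have box (y : Y) (hy : φ (G (e y) x₀) < r) : ∃ V U, IsOpen V ∧ IsOpen U ∧ y ∈ V ∧ x₀ ∈ U ∧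
      ∀ y ∈ V, ∀ x ∈ U, φ (G (e y) x) ≤ r := by
    obtain ⟨V, U, hV, hU, hyV, hxU, hVU⟩ :=
      isOpen_prod_iff.1 (isOpen_lt hφYX continuous_const) y x₀ hy
    exact ⟨V, U, hV, hU, hyV, hxU, fun y hy x hx => le_of_lt (hVU (mk_mem_prod hy hx))⟩
  choose! V U hV hU hyV hxU hVU using box
  obtain ⟨y, x, hy, hxm, hs⟩ := hseq U fun y hy => (hU y hy).mem_nhds (hxU y hy)
  exact hrs.not_ge <| le_of_forall_mem_box (fun x => hφYX.comp (.prodMk_left x))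
    (fun y => hφYX.comp (.prodMk_right y)) (fun n => hV _ (hy n)) (fun n => hU _ (hy n))
    (fun n => hyV _ (hy n)) hxm (fun n => hVU _ (hy n)) fun n m h => (hs n m h).le

theorem doubleLimitProperty_of_continuous {Y Z : Type*} [TopologicalSpace Y]
    [PseudocompactSpace Y] [TopologicalSpace Z] [CompactSpace Z] [T2Space Z] {g : Y → X → Z}
    (hg : Continuous fun z : Y × X => g z.1 z.2) : DoubleLimitProperty g := by
  have hY (x) : Continuous fun y => g y x := hg.comp (.prodMk_left x)
  let G (q : StoneCech Y) (x : X) : Z := stoneCechExtend (hY x) q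
  have hGg (y x) : G (stoneCechUnit y) x = g y x := stoneCechExtend_stoneCechUnit (hY x) y
  have hGK (x) : Continuous fun q => G q x := continuous_stoneCechExtend (hY x)
  have hGX : ∀ q, Continuous (G q) :=
    continuous_of_continuous_uncurry denseRange_stoneCechUnit hGK (by simpa only [hGg] using hg)
  rw [← funext₂ hGg]
  exact (doubleLimitProperty_of_compactSpace hGX hGK).flip.comp_left stoneCechUnit

end PseudocompactSpace

/-- The points of `∏ i, βX i` whose coordinates outside `S` lie in `X i`; it encodes the partial
compactification `∏ i ∈ S, βX i × ∏ i ∉ S, X i`. -/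
def partialStoneCech {ι : Type*} (X : ι → Type*) [∀ i, TopologicalSpace (X i)] (S : Finset ι) :
    Set (∀ i, StoneCech (X i)) :=
  {c | ∀ i ∉ S, c i ∈ range stoneCechUnit}

/-- `F` extends `f` and is separately continuous on the partial compactification
`partialStoneCech X S` in the coordinates from `S`. The values of `F` at other points are
irrelevant. -/
structure IsSeparatelyContinuousExtension {ι : Type*} [DecidableEq ι] {X : ι → Type*}
    [∀ i, TopologicalSpace (X i)] {Z : Type*} [TopologicalSpace Z] (f : (∀ i, X i) → Z)
    (S : Finset ι) (F : (∀ i, StoneCech (X i)) → Z) : Prop where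
  apply_unit : ∀ x : ∀ i, X i, F (fun i => stoneCechUnit (x i)) = f x
  continuous_update : ∀ c ∈ partialStoneCech X S, ∀ i ∈ S, Continuous fun b => F (update c i b)

namespace partialStoneCech

variable {ι : Type*} {X : ι → Type*} [∀ i, TopologicalSpace (X i)] {S T : Finset ι}

theorem mono (h : S ⊆ T) : partialStoneCech X S ⊆ partialStoneCech X T :=
  fun _ hc i hi => hc i fun hiS => hi (h hiS)

variable {c : ∀ i, StoneCech (X i)}

theorem exists_forall_notMem_eq (hc : c ∈ partialStoneCech X S) :
    ∃ z : ∀ i, X i, ∀ i ∉ S, stoneCechUnit (z i) = c i := by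
  have (i : ι) : Nonempty (X i) := denseRange_stoneCechUnit.nonempty_iff.2 ⟨c i⟩
  choose! z hz using hc
  exact ⟨z, hz⟩

variable [DecidableEq ι] {i : ι}

theorem update_mem (hc : c ∈ partialStoneCech X S) (hi : i ∈ S) (b : StoneCech (X i)) :
    update c i b ∈ partialStoneCech X S := fun k hk => by
  rw [update_of_ne (ne_of_mem_of_not_mem hi hk).symm]
  exact hc k hk

theorem update_unit_mem (hc : c ∈ partialStoneCech X (insert i S)) (x : X i) :
    update c i (stoneCechUnit x) ∈ partialStoneCech X S := fun k hk => by
  rcases eq_or_ne k i with rfl | hki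
  · simp
  · rw [update_of_ne hki]
    exact hc k (by simp [hki, hk])

end partialStoneCech

namespace IsSeparatelyContinuousExtension

open partialStoneCech

variable {ι : Type*} [DecidableEq ι] {X : ι → Type*} [∀ i, TopologicalSpace (X i)]
  {S T : Finset ι} {c : ∀ i, StoneCech (X i)} {i j : ι} {Z : Type*} [TopologicalSpace Z]
  {f : (∀ i, X i) → Z} {F : (∀ i, StoneCech (X i)) → Z}

theorem apply_of_forall_eq (hF : IsSeparatelyContinuousExtension f S F) {x : ∀ i, X i}
    (h : ∀ i, stoneCechUnit (x i) = c i) : F c = f x := by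
  rw [← hF.apply_unit, funext h]

variable [∀ i, PseudocompactSpace (X i)]

theorem doubleLimitProperty [CompactSpace Z] [T2Space Z]
    (hF : IsSeparatelyContinuousExtension f S F) (hf : Continuous f) (hij : i ≠ j) (hTS : T ⊆ S)
    (hi : i ∉ T) (hj : j ∉ T) (hc : c ∈ partialStoneCech X (insert i (insert j T))) :
    DoubleLimitProperty fun (x : X i) (y : X j) =>
      F (update (update c i (stoneCechUnit x)) j (stoneCechUnit y)) := by
  induction T using Finset.induction_on generalizing c with
  | empty =>
    obtain ⟨z, hz⟩ := exists_forall_notMem_eq hc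
    have hFf (x : X i) (y : X j) : F (update (update c i (stoneCechUnit x)) j (stoneCechUnit y)) =
        f (update (update z i x) j y) := by
      refine hF.apply_of_forall_eq fun k => ?_
      rcases eq_or_ne k j with rfl | hkj
      · simp
      rcases eq_or_ne k i with rfl | hki
      · simp [hkj]
      · simpa [hki, hkj] using hz k (by simp [hki, hkj])
    simp only [hFf]
    exact PseudocompactSpace.doubleLimitProperty_of_continuous
      (g := fun x y => f (update (update z i x) j y)) (by fun_prop)
  | insert k T _ ih =>
    obtain ⟨hkS, hTS⟩ := Finset.insert_subset_iff.1 hTS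
    obtain ⟨hik, hiT⟩ := not_or.1 (Finset.mem_insert.not.1 hi)
    obtain ⟨hjk, hjT⟩ := not_or.1 (Finset.mem_insert.not.1 hj)
    rw [Finset.insert_comm j, Finset.insert_comm i] at hc
    simpa using PseudocompactSpace.doubleLimitProperty_of_denseRange continuous_stoneCechUnit
      denseRange_stoneCechUnit
      (G := fun q x y => F (update (update (update c k q) i (stoneCechUnit x)) j (stoneCechUnit y)))
      (fun x y => by
        simp only [update_comm (Ne.symm hik), update_comm (Ne.symm hjk)]
        refine hF.continuous_update _ (mono (Finset.insert_subset hkS hTS) ?_) k hkS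
        rw [Finset.insert_comm k, Finset.insert_comm k] at hc
        exact update_unit_mem (update_unit_mem hc x) y)
      (fun x => ih hTS hiT hjT (update_unit_mem hc x)) (c k)

theorem continuous_update_unit [CompactSpace Z] [T2Space Z]
    (hF : IsSeparatelyContinuousExtension f S F) (hf : Continuous f) (hj : j ∉ S) (hTS : T ⊆ S)
    (hc : c ∈ partialStoneCech X (insert j T)) :
    Continuous fun x : X j => F (update c j (stoneCechUnit x)) := by
  induction T using Finset.induction_on generalizing c with
  | empty =>
    obtain ⟨z, hz⟩ := exists_forall_notMem_eq hc
    have hFf (x : X j) : F (update c j (stoneCechUnit x)) = f (update z j x) := by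
      refine hF.apply_of_forall_eq fun k => ?_
      rcases eq_or_ne k j with rfl | hkj
      · simp
      · simpa [hkj] using hz k (by simp [hkj])
    simp only [hFf]
    fun_prop
  | insert i T hi ih =>
    obtain ⟨hiS, hTS⟩ := Finset.insert_subset_iff.1 hTS
    have hij : i ≠ j := ne_of_mem_of_not_mem hiS hj
    have hci := (Finset.insert_comm j i T) ▸ hc
    simpa using (hF.doubleLimitProperty hf hij hTS hi (mt (@hTS j) hj)
      hci).continuous_of_denseRange denseRange_stoneCechUnit
      (G := fun q x => F (update (update c i q) j (stoneCechUnit x)))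
      (fun x => by
        simp only [update_comm hij]
        exact hF.continuous_update _
          (mono (Finset.insert_subset hiS hTS) (update_unit_mem hc x)) i hiS)
      (fun x => ih hTS (update_unit_mem hci x)) (c i)

theorem exists_insert [CompactSpace Z] [T2Space Z]
    (hF : IsSeparatelyContinuousExtension f S F) (hf : Continuous f) (hj : j ∉ S) :
    ∃ F', IsSeparatelyContinuousExtension f (insert j S) F' := by
  let F' (c : ∀ i, StoneCech (X i)) : Z :=
    isDenseInducing_stoneCechUnit.extend (fun x => F (update c j (stoneCechUnit x))) (c j)
  have hF' {c} (hc : c ∈ partialStoneCech X (insert j S)) (b) : F' (update c j b) =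
      stoneCechExtend (hF.continuous_update_unit hf hj subset_rfl hc) b := by
    simp only [F', update_idem, update_self]
    exact congrFun (isDenseInducing_stoneCechUnit.extend_unique
      (stoneCechExtend_stoneCechUnit _) (continuous_stoneCechExtend _)) b
  have hF'j {c} (hc : c ∈ partialStoneCech X (insert j S)) :
      Continuous fun b => F' (update c j b) := by
    simp only [hF' hc]
    exact continuous_stoneCechExtend _
  have hF'F {c} (hc : c ∈ partialStoneCech X (insert j S)) (x) :
      F' (update c j (stoneCechUnit x)) = F (update c j (stoneCechUnit x)) := by
    rw [hF' hc, stoneCechExtend_stoneCechUnit]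
  refine ⟨F', fun x => ?_, fun c hc i hi => ?_⟩
  · have := hF'F (c := fun i => stoneCechUnit (x i)) (fun i _ => mem_range_self _) (x j)
    rwa [update_eq_self, hF.apply_unit] at this
  rcases eq_or_ne i j with rfl | hij
  · exact hF'j hc
  have hiS : i ∈ S := Finset.mem_of_mem_insert_of_ne hi hij
  have hcb (b) := update_mem hc hi b
  simpa [update_comm hij] using PseudocompactSpace.continuous_of_compactSpace
    continuous_stoneCechUnit denseRange_stoneCechUnit
    (G := fun q b => F' (update (update c i b) j q))
    (fun b => hF'j (hcb b))
    (fun x => by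
      simp_rw [hF'F (hcb _), update_comm hij]
      exact hF.continuous_update _ (update_unit_mem hc x) i hiS) (c j)

theorem exists_of_continuous [CompactSpace Z] [T2Space Z] (hf : Continuous f) (S : Finset ι) :
    ∃ F, IsSeparatelyContinuousExtension f S F := by
  induction S using Finset.induction_on with
  | empty =>
    have hd : IsDenseInducing (Pi.map fun i => (stoneCechUnit : X i → StoneCech (X i))) :=
      ⟨.piMap fun _ => isDenseInducing_stoneCechUnit.toIsInducing,
        .piMap fun _ => denseRange_stoneCechUnit⟩
    exact ⟨hd.extend f, hd.extend_eq hf, by simp⟩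
  | insert j S hj ih =>
    obtain ⟨F, hF⟩ := ih
    exact hF.exists_insert hf hj

theorem continuous_of_forall_continuous [CompletelyRegularSpace Z] {P : Type*} [TopologicalSpace P]
    [CompactlyCoherentSpace P] {f : P → (∀ i, X i) → Z} {F : P → (∀ i, StoneCech (X i)) → Z}
    (hF : ∀ t, IsSeparatelyContinuousExtension (f t) S (F t))
    (hf : ∀ x, Continuous fun t => f t x) (hTS : T ⊆ S) (hc : c ∈ partialStoneCech X T) :
    Continuous fun t => F t c := by
  induction T using Finset.induction_on generalizing c with
  | empty =>
    obtain ⟨z, hz⟩ := exists_forall_notMem_eq hc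
    simp only [fun t => (hF t).apply_of_forall_eq fun i => hz i (Finset.notMem_empty i)]
    exact hf z
  | insert i T _ ih =>
    obtain ⟨hiS, hTS⟩ := Finset.insert_subset_iff.1 hTS
    refine CompactlyCoherentSpace.isCoherentWith.continuous_iff.2 fun K hK => ?_
    have : CompactSpace K := isCompact_iff_compactSpace.1 hK
    rw [continuousOn_iff_continuous_domRestrict]
    simpa [domRestrict_def] using PseudocompactSpace.continuous_of_compactSpace
      continuous_stoneCechUnit denseRange_stoneCechUnit (G := fun q (t : K) => F t (update c i q))
      (fun t => (hF t).continuous_update c (mono (Finset.insert_subset hiS hTS) hc) i hiS)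
      (fun x => (ih hTS (update_unit_mem hc x)).comp continuous_subtype_val) (c i)

end IsSeparatelyContinuousExtension

theorem compactlyCoherentSpace_of_isClosedEmbedding {X Y : Type*} [TopologicalSpace X]
    [TopologicalSpace Y] [CompactlyCoherentSpace Y] {f : X → Y} (hf : IsClosedEmbedding f) :
    CompactlyCoherentSpace X := by
  refine .of_isClosed fun A hA => ?_
  rw [hf.isClosed_iff_image_isClosed, CompactlyCoherentSpace.isClosed_iff]
  intro K hK
  have hKA := hf.isClosedMap.restrictPreimage K _ (hA _ (hf.isCompact_preimage hK))
  convert hKA using 1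
  ext ⟨y, hy⟩
  aesop

theorem corollaryc_general {E X : Type*} [TopologicalSpace E] [CompactlyCoherentSpace E]
    [TopologicalSpace X] [PseudocompactSpace X] (σ : ContinuousSignature E) (A : EAlgebra σ X)
    (hE : ∀ n x, Continuous fun t => A.op n (t, x))
    (hX : ∀ n t, Continuous fun x => A.op n (t, x)) :
    ∃ B : EAlgebra σ (StoneCech X),
      B.IsSemitopological ∧ A.IsHom B (stoneCechUnit : X → StoneCech X) := by
  choose F hF using fun n t => IsSeparatelyContinuousExtension.exists_of_continuous
    (continuous_stoneCechUnit.comp (hX n t)) Finset.univ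
  have hmem {n} (c : Fin n → StoneCech X) :
      c ∈ partialStoneCech (fun _ => X) Finset.univ := by simp [partialStoneCech]
  refine ⟨⟨fun n z => F n z.1 z.2⟩, fun n => ⟨fun c => ?_, fun t c i => ?_⟩,
    fun n t x => ((hF n t).apply_unit x).symm⟩
  · have : CompactlyCoherentSpace (σ.Symbols n) :=
      compactlyCoherentSpace_of_isClosedEmbedding
        (σ.isClopen_fiber n).isClosed.isClosedEmbedding_subtypeVal
    exact IsSeparatelyContinuousExtension.continuous_of_forall_continuous (hF n)
      (fun x => continuous_stoneCechUnit.comp (hE n x)) subset_rfl (hmem c)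
  · exact (hF n t).continuous_update c (hmem c) i (Finset.mem_univ i)

/-- `CompactlyCoherentSpace E` says that `E` is a `k`-space. The canonical dense embedding
`stoneCechUnit : X → StoneCech X` being a homomorphism says that the operations on `StoneCech X`
extend those of `X`. -/
theorem corollaryc {E X : Type*} [TopologicalSpace E] [T35Space E] [CompactlyCoherentSpace E]
    [TopologicalSpace X] [PseudocompactSpace X]
    (σ : ContinuousSignature E) (A : EAlgebra σ X) (hA : A.IsTopological) :
    ∃ B : EAlgebra σ (StoneCech X),
      B.IsSemitopological ∧ A.IsHom B (stoneCechUnit : X → StoneCech X) := by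
  exact corollaryc_general σ A (fun n x => (hA n).comp (.prodMk_left x)) fun n t =>
    (hA n).comp (.prodMk_right t)
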